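/- Let $d\ge 2$, let $e_0,\dots,e_{d-1}\in\mathbb{C}$ be distinct, let $f(w)=(w-e_0)\cdots(w-e_{d-1})$, and let $\eta_j=1/f'(e_j)$. The Poincaré compactification of $\dot w=f(w)$, in real time, is the following flow on the closed disk $\mathbf{D}$. Realize $\mathbf{D}$ as the closed hemisphere $\{(x,s)\in\mathbb{C}\times\mathbb{R}:\ |x|^2+s^2=1,\ s\ge 0\}$, with interior $\mathbb{D}=\{s>0\}$, which is identified with $\mathbb{C}$ by central projection $w=x/s$, and with boundary circle $\mathbb{S}^1=\{s=0\}$. With $F(x,s)=\prod_{j}(x-e_js)$, the flow is generated by $$\dot x=F-\mathrm{Re}(\bar xF)\,x,\qquad \dot s=-\,\mathrm{Re}(\bar xF)\,s .$$ On $\mathbb{D}$ this is $\dot w=s^{d-1}f(w)$, i.e. $\dot w=f(w)$ up to a positive real rescaling of time. The equilibria on $\mathbb{S}^1$ are the $2(d-1)$ points $(e^{-\mathrm{i}\alpha_k},0)$ with $\alpha_k=\pi k/(d-1)$, $0\le k<2(d-1)$; all of them are hyperbolic saddles, called boundary saddles. An interior saddle connection $\gamma:\mathbf{A}\leadsto\mathbf{B}$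 is an orbit of this flow in $\mathbb{D}$ which converges to boundary saddles $\mathbf{A}$, $\mathbf{B}$ as time tends to $-\infty$, $+\infty$, respectively. Let $\gamma:\mathbf{A}\leadsto\mathbf{B}$ be an interior saddle connection, and let $J$ be the set of those indices $j\in\{0,\dots,d-1\}$ for which the interior equilibrium $e_j$ lies on the opposite side of $e_0$, i.e. does not lie in the connected component of $\mathbb{D}\setminus\gamma$ that contains $e_0$. Then $J$ is nonempty, and $$\sum_{j\in J}\mathrm{Re}\,\eta_j=0 .$$ -/

import Mathlib

open scoped Topology

noncomputable section

namespace PoincareCompactification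

variable {d : ℕ}

/-- The monic polynomial `f(w) = (w - e₀) ⋯ (w - e_{d-1})` with zeros `e_j`. -/
def poly (e : Fin d → ℂ) : Polynomial ℂ :=
  ∏ j, (Polynomial.X - Polynomial.C (e j))

/-- The reciprocal linearization `η_j = 1 / f'(e_j)` at the equilibrium `e_j`. -/
def eta (e : Fin d → ℂ) (j : Fin d) : ℂ :=
  1 / (poly e).derivative.eval (e j)

/-- The homogenization `F(x, s) = s ^ d * f(x / s) = (x - e₀ s) ⋯ (x - e_{d-1} s)`. -/
def homog (e : Fin d → ℂ) (p : ℂ × ℝ) : ℂ :=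
  ∏ j, (p.1 - e j * (p.2 : ℂ))

/-- The closed disk of the Poincaré compactification, realized as the closed hemisphere
`|x|² + s² = 1`, `s ≥ 0`. -/
def closedDisk : Set (ℂ × ℝ) := {p | ‖p.1‖ ^ 2 + p.2 ^ 2 = 1 ∧ 0 ≤ p.2}

/-- The interior (open disk): the open hemisphere `s > 0`. -/
def openDisk : Set (ℂ × ℝ) := {p | p ∈ closedDisk ∧ 0 < p.2}

/-- The boundary circle ("circle at infinity"): the equator `s = 0`. -/
def boundaryCircle : Set (ℂ × ℝ) := {p | p ∈ closedDisk ∧ p.2 = 0}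

/-- Central projection of `w ∈ ℂ` (the tangent plane at the pole `(0, 1)`) to the open
hemisphere; its inverse is `(x, s) ↦ x / s`. -/
def toDisk (w : ℂ) : ℂ × ℝ :=
  (w / (Real.sqrt (1 + ‖w‖ ^ 2) : ℂ), 1 / Real.sqrt (1 + ‖w‖ ^ 2))

/-- The vector field of the Poincaré compactification of `ẇ = f(w)`: the component of
`(F, 0)` tangent to the hemisphere,
`ẋ = F - Re(x̄ F) x`, `ṡ = - s Re(x̄ F)`.
On the open disk it is the image of `ẇ = f(w)` under central projection, up to the positive
Euler multiplier `s ^ (d - 1)`, see `velocity_eq`; it is smooth up to the boundary circle,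
which it leaves invariant. -/
def compactField (e : Fin d → ℂ) (p : ℂ × ℝ) : ℂ × ℝ :=
  (homog e p - (((starRingEnd ℂ) p.1 * homog e p).re : ℂ) * p.1,
    -(p.2 * ((starRingEnd ℂ) p.1 * homog e p).re))

/-- The boundary equilibria of the compactified flow. All of them are hyperbolic saddles, and
there are `2 (d - 1)` of them, see `mem_boundarySaddles_iff`. -/
def boundarySaddles (e : Fin d → ℂ) : Set (ℂ × ℝ) :=
  {p | p ∈ boundaryCircle ∧ compactField e p = 0}

/-- `γ` is a (time-parametrized) interior saddle connection from `A` to `B`: a heteroclinic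
orbit of the compactified flow in the open disk between boundary saddles `A` and `B`. -/
structure IsInteriorSaddleConnection (e : Fin d → ℂ) (A B : ℂ × ℝ) (γ : ℝ → ℂ × ℝ) : Prop where
  source_mem : A ∈ boundarySaddles e
  target_mem : B ∈ boundarySaddles e
  mem_openDisk : ∀ t, γ t ∈ openDisk
  orbit : ∀ t, HasDerivAt γ (compactField e (γ t)) t
  tendsto_source : Filter.Tendsto γ Filter.atBot (𝓝 A)
  tendsto_target : Filter.Tendsto γ Filter.atTop (𝓝 B)

open Classical in
/-- The indices `j` of those interior equilibria which do not lie in the same connected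
component of the open disk minus the orbit `γ` as the equilibrium with index `i`. -/
def oppositeSide (e : Fin d → ℂ) (γ : ℝ → ℂ × ℝ) (i : Fin d) : Finset (Fin d) :=
  {j | toDisk (e j) ∉ connectedComponentIn (openDisk \ Set.range γ) (toDisk (e i))}

/-- The compactified field moves `w = x / s` with velocity `s ^ (d - 1) * f(w)`. -/
theorem velocity_eq (e : Fin d → ℂ) (hd : 1 ≤ d) (p : ℂ × ℝ) (hp : 0 < p.2) :
    ((compactField e p).1 * p.2 - p.1 * (compactField e p).2) / (p.2 : ℂ) ^ 2
      = (p.2 : ℂ) ^ (d - 1) * (poly e).eval (p.1 / p.2) := by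
  have hs : (p.2 : ℂ) ≠ 0 := by exact_mod_cast hp.ne'
  have hF : homog e p = (p.2 : ℂ) ^ d * (poly e).eval (p.1 / p.2) := by
    have h1 : ∀ j, p.1 - e j * (p.2 : ℂ) = p.2 * (p.1 / p.2 - e j) := by
      intro j; field_simp
    simp only [homog, poly, Polynomial.eval_prod, Polynomial.eval_sub, Polynomial.eval_X,
      Polynomial.eval_C, h1, Finset.prod_mul_distrib, Finset.prod_const, Finset.card_univ,
      Fintype.card_fin]
  obtain ⟨n, rfl⟩ : ∃ n, d = n + 1 := ⟨d - 1, by omega⟩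
  simp only [compactField, Nat.add_sub_cancel]
  push_cast
  rw [hF]
  field_simp
  ring

/-- The boundary saddles are the points at angles `α_k = π k / (d - 1)`, `0 ≤ k < 2 (d - 1)`,
where `α` is the angle of `z = 1 / w`. -/
theorem mem_boundarySaddles_iff (e : Fin d → ℂ) (hd : 2 ≤ d) (p : ℂ × ℝ) :
    p ∈ boundarySaddles e ↔ ∃ k < 2 * (d - 1),
      p = (Complex.exp (-(Real.pi * k / (d - 1 : ℕ) * Complex.I)), 0) := by
  obtain ⟨n, rfl⟩ : ∃ n, d = n + 1 := ⟨d - 1, by omega⟩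
  have hn : n ≠ 0 := by omega
  have hnC : (n : ℂ) ≠ 0 := by exact_mod_cast hn
  simp only [Nat.add_sub_cancel]
  obtain ⟨x, s⟩ := p
  have key : (x, s) ∈ boundarySaddles e ↔ s = 0 ∧ x⁻¹ ^ (2 * n) = 1 := by
    constructor
    · rintro ⟨⟨⟨h1, -⟩, h2⟩, h3⟩
      simp only at h1 h2
      subst h2
      refine ⟨rfl, ?_⟩
      have hc : (starRingEnd ℂ) x * x = 1 := by
        rw [mul_comm, Complex.mul_conj, Complex.normSq_eq_norm_sq]
        have : ‖x‖ ^ 2 = 1 := by simpa using h1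
        simp [this]
      have hx : x ≠ 0 := by rintro rfl; simp at hc
      have h4 := congrArg Prod.fst h3
      simp only [compactField, homog, Complex.ofReal_zero, mul_zero, sub_zero,
        Finset.prod_const, Finset.card_univ, Fintype.card_fin, Prod.fst_zero] at h4
      have h5 : (starRingEnd ℂ) x * x ^ (n + 1) = x ^ n := by
        rw [pow_succ', ← mul_assoc, hc, one_mul]
      rw [h5, pow_succ, ← sub_mul] at h4
      have h6 : x ^ n = ((x ^ n).re : ℂ) :=
        sub_eq_zero.mp ((mul_eq_zero.mp h4).resolve_right hx)
      have h7 : (starRingEnd ℂ) (x ^ n) * x ^ n = 1 := by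
        rw [map_pow, ← mul_pow, hc, one_pow]
      have h8 : (starRingEnd ℂ) (x ^ n) = x ^ n := by rw [h6, Complex.conj_ofReal]
      rw [h8] at h7
      rw [inv_pow, two_mul, pow_add, h7, inv_one]
    · rintro ⟨rfl, hx⟩
      have hx' : x ^ (2 * n) = 1 := by rw [inv_pow] at hx; simpa using hx
      have hnorm : ‖x‖ = 1 := Complex.norm_eq_one_of_pow_eq_one hx' (by omega)
      have hc : (starRingEnd ℂ) x * x = 1 := by
        rw [mul_comm, Complex.mul_conj, Complex.normSq_eq_norm_sq, hnorm]; simp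
      refine ⟨⟨⟨by simp [hnorm], le_refl _⟩, rfl⟩, ?_⟩
      have h5 : (starRingEnd ℂ) x * x ^ (n + 1) = x ^ n := by
        rw [pow_succ', ← mul_assoc, hc, one_mul]
      have h9 : x ^ n = 1 ∨ x ^ n = -1 := by
        rw [two_mul, pow_add] at hx'; exact mul_self_eq_one_iff.mp hx'
      simp only [compactField, homog, Complex.ofReal_zero, mul_zero, sub_zero,
        Finset.prod_const, Finset.card_univ, Fintype.card_fin, zero_mul, neg_zero, h5]
      rcases h9 with h | h <;> simp [h, pow_succ]
  rw [key]
  have hprim := Complex.isPrimitiveRoot_exp (2 * n) (by omega)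
  have hexp : ∀ k : ℕ, Complex.exp (-(Real.pi * k / n * Complex.I))
      = (Complex.exp (2 * Real.pi * Complex.I / (2 * n : ℕ)) ^ k)⁻¹ := by
    intro k
    rw [← Complex.exp_nat_mul, ← Complex.exp_neg]
    congr 1
    push_cast
    field_simp
  constructor
  · rintro ⟨rfl, hx⟩
    have : NeZero (2 * n) := ⟨by omega⟩
    obtain ⟨k, hk, hk'⟩ := hprim.eq_pow_of_pow_eq_one hx
    exact ⟨k, hk, by rw [hexp, hk', inv_inv]⟩
  · rintro ⟨k, -, h⟩
    rw [Prod.mk.injEq] at h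
    refine ⟨h.2, ?_⟩
    rw [h.1, hexp, inv_inv, ← pow_mul, mul_comm k, pow_mul, hprim.pow_eq_one, one_pow]

end PoincareCompactification

end

namespace PoincareCompactification

open Set Filter

/-! In the chart `w = x / s` the connection is a closed curve through infinity with `dw = f(w) ρ dt`
and `ρ > 0`. Partial fractions give `1/f = ∑ η_j / (w - e_j)`. Since `∑ η_j = 0`, multiples of `1/(w
- e_0)` may be subtracted, so `ρ dt` is the sum of `η_j` times the logarithmic differential of `(w -
e_j)/(w - e_0)`. This ratio tends to `1` at both ends of the orbit, hence its logarithmic increment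
`z_j` exists and is imaginary.

The increment is locally constant in `e_j` off the orbit, so it vanishes on the component of `e_0`.
Flow boxes show that the complement of the orbit has at most two components
(`mem_component_of_notMem`), so all `j ∈ J` share a single value `z`. Integrating, `z * ∑_{j ∈ J}
η_j = ∫ ρ dt` is real and positive. Therefore `J` is nonempty, `z` is nonzero and imaginary, and the
sum is imaginary. Positivity of `ρ` replaces the Jordan curve theorem: neither the existence of a
second component nor the value of the winding number is needed. -/

/-- An injective, nonconstant trajectory of `ẇ = f(w)`, up to the positive rescaling `ρ` of time,
which escapes to infinity in both time directions. -/
structure IsProperOrbit (f : ℂ → ℂ) (ρ : ℝ → ℝ) (w : ℝ → ℂ) : Prop where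
  pos : ∀ t, 0 < ρ t
  continuous_rate : Continuous ρ
  hasDerivAt : ∀ t, HasDerivAt w (ρ t * f (w t)) t
  ne_zero : ∀ t, f (w t) ≠ 0
  injective : Function.Injective w
  tendsto_atBot : Tendsto (fun t => ‖w t‖) atBot atTop
  tendsto_atTop : Tendsto (fun t => ‖w t‖) atTop atTop

/-! ### Topology of a proper orbit: flow boxes and complementary components. -/

namespace IsProperOrbit

variable {f : ℂ → ℂ} {ρ : ℝ → ℝ} {w : ℝ → ℂ}

theorem continuous (h : IsProperOrbit f ρ w) : Continuous w :=
  continuous_iff_continuousAt.2 fun t => (h.hasDerivAt t).continuousAt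

/-- Escape to infinity at both ends of time makes `w` a proper map. -/
theorem isClosedMap (h : IsProperOrbit f ρ w) : IsClosedMap w := by
  have : IsProperMap w := by
    rw [isProperMap_iff_tendsto_cocompact]
    refine ⟨h.continuous, ?_⟩
    rw [← Metric.cobounded_eq_cocompact (α := ℂ), ← comap_norm_atTop, tendsto_comap_iff,
      cocompact_eq_atBot_atTop]
    exact h.tendsto_atBot.sup h.tendsto_atTop
  exact this.isClosedMap

theorem isClosed_range (h : IsProperOrbit f ρ w) : IsClosed (range w) :=
  h.isClosedMap.isClosed_range

/-- Local straightening of the trajectory by a holomorphic complex time. -/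
theorem exists_complexTime (h : IsProperOrbit f ρ w) (hf : Differentiable ℂ f) (t₀ : ℝ) :
    ∃ φ : OpenPartialHomeomorph ℂ ℂ, w t₀ ∈ φ.source ∧
      ∀ y ∈ φ.source, HasDerivAt φ (f y)⁻¹ y := by
  obtain ⟨r, hr, hball⟩ := Metric.mem_nhds_iff.1 (hf.continuous.continuousAt.eventually_ne
    (h.ne_zero t₀))
  have hdiff : DifferentiableOn ℂ (fun y => (f y)⁻¹) (Metric.ball (w t₀) r) :=
    fun y hy => (hf y).differentiableWithinAt.inv (hball hy)
  -- Complex time is a primitive of `1/f`; its derivative does not vanish, so it is locally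
  -- invertible.
  obtain ⟨Φ, hΦ⟩ := hdiff.isExactOn_ball
  have hmem : w t₀ ∈ Metric.ball (w t₀) r := Metric.mem_ball_self hr
  have hΦd : DifferentiableOn ℂ Φ (Metric.ball (w t₀) r) :=
    fun y hy => (hΦ y hy).differentiableAt.differentiableWithinAt
  have hstrict : HasStrictDerivAt Φ (f (w t₀))⁻¹ (w t₀) := by
    have := (hΦd.analyticAt (Metric.isOpen_ball.mem_nhds hmem)).hasStrictDerivAt
    rwa [(hΦ _ hmem).deriv] at this
  have hs := hstrict.hasStrictFDerivAt_equiv (inv_ne_zero (h.ne_zero t₀))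
  refine ⟨(hs.toOpenPartialHomeomorph Φ).restrOpen (Metric.ball (w t₀) r) Metric.isOpen_ball, ?_, ?_⟩
  · exact ⟨hs.mem_toOpenPartialHomeomorph_source, hmem⟩
  · rintro y ⟨-, hy⟩
    exact hΦ y hy

/-- Both sides of a flow box around the point `w t₀` are connected, they contain the normal germs
of the trajectory near `t₀`, and they are met by every open set adherent to `w t₀`. -/
theorem exists_sides (h : IsProperOrbit f ρ w) (hf : Differentiable ℂ f) (t₀ : ℝ) :
    ∃ S : ℝ → Set ℂ, (∀ σ, IsPreconnected (S σ)) ∧ (∀ σ, S σ ⊆ (range w)ᶜ) ∧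
      (∀ σ, σ ≠ 0 → ∀ᶠ t in 𝓝 t₀, ∀ᶠ ε : ℝ in 𝓝[>] 0,
        w t + ε * (σ * Complex.I * f (w t)) ∈ S σ) ∧
      ∀ V, IsOpen V → w t₀ ∈ closure V → (V ∩ S 1).Nonempty ∨ (V ∩ S (-1)).Nonempty := by
  obtain ⟨φ, hφ0, hφ⟩ := h.exists_complexTime hf t₀
  set z₀ := φ (w t₀) with hz₀
  have hz₀t : z₀ ∈ φ.target := φ.map_source hφ0
  -- a time interval on which the trajectory stays in the chart
  obtain ⟨δ, hδ, hδs⟩ := Metric.mem_nhds_iff.1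
    (h.continuous.continuousAt.preimage_mem_nhds (φ.open_source.mem_nhds hφ0))
  -- In complex time the orbit has real velocity `ρ`, so it runs along a horizontal line.
  have him : ∀ t ∈ Metric.ball t₀ δ, (φ (w t)).im = z₀.im := by
    have hd : ∀ t ∈ Metric.ball t₀ δ, HasDerivAt (fun t => (φ (w t)).im) 0 t := by
      intro t ht
      have h1 := HasDerivAt.scomp t (hφ (w t) (hδs ht)) (h.hasDerivAt t)
      have h2 : (ρ t * f (w t)) • (f (w t))⁻¹ = ((ρ t : ℝ) : ℂ) := by
        rw [smul_eq_mul, mul_assoc, mul_inv_cancel₀ (h.ne_zero t), mul_one]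
      rw [h2] at h1
      have h3 := Complex.imCLM.hasFDerivAt.comp_hasDerivAt t h1
      rwa [Complex.imCLM_apply, Complex.ofReal_im] at h3
    intro t ht
    refine (convex_ball t₀ δ).is_const_of_fderivWithin_eq_zero (𝕜 := ℝ)
      (f := fun t => (φ (w t)).im)
      (fun s hs => (hd s hs).differentiableAt.differentiableWithinAt) (fun s hs => ?_) ht
      (Metric.mem_ball_self hδ)
    rw [fderivWithin_of_isOpen Metric.isOpen_ball hs, (hd s hs).hasFDerivAt.fderiv]
    simp
  -- the rest of the trajectory stays away from `w t₀`
  have hfar : (w '' (Metric.ball t₀ δ)ᶜ)ᶜ ∈ 𝓝 (w t₀) := by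
    refine (h.isClosedMap _ Metric.isOpen_ball.isClosed_compl).isOpen_compl.mem_nhds ?_
    rintro ⟨s, hs, hst⟩
    exact hs (h.injective hst ▸ Metric.mem_ball_self hδ)
  have hsymm : φ.symm z₀ = w t₀ := φ.left_inv hφ0
  obtain ⟨r, hr, hball⟩ := Metric.mem_nhds_iff.1 (inter_mem (φ.open_target.mem_nhds hz₀t)
    ((φ.continuousAt_symm hz₀t).preimage_mem_nhds (hsymm.symm ▸ hfar)))
  have hcont : ContinuousOn φ.symm (Metric.ball z₀ r) :=
    φ.continuousOn_symm.mono fun z hz => (hball hz).1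
  have hUopen : IsOpen (φ.source ∩ φ ⁻¹' Metric.ball z₀ r) :=
    φ.isOpen_inter_preimage Metric.isOpen_ball
  have hUmem : w t₀ ∈ φ.source ∩ φ ⁻¹' Metric.ball z₀ r := ⟨hφ0, Metric.mem_ball_self hr⟩
  -- For `σ = 1` and `σ = -1` these are the upper and lower half disks of the flow box; `him` and
  -- `hfar` keep them off the orbit.
  let S : ℝ → Set ℂ := fun σ =>
    φ.symm '' (Metric.ball z₀ r ∩ {z | 0 < σ * (z.im - z₀.im)})
  refine ⟨S, fun σ => ?_, fun σ => ?_, fun σ hσ => ?_, fun V hV hcl => ?_⟩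
  · refine IsPreconnected.image (Convex.isPreconnected ?_) _ (hcont.mono inter_subset_left)
    refine (convex_ball _ _).inter ?_
    intro a ha b hb s t hs ht hst
    simp only [mem_ofPred_eq, Complex.add_im, Complex.smul_im, smul_eq_mul] at ha hb ⊢
    have : σ * (s * a.im + t * b.im - z₀.im) =
        s * (σ * (a.im - z₀.im)) + t * (σ * (b.im - z₀.im)) := by
      have : z₀.im = (s + t) * z₀.im := by rw [hst, one_mul]
      linear_combination (-σ) * this
    rw [this]
    rcases hs.eq_or_lt with rfl | hs'
    · have : t = 1 := by linarith
      subst this; simpa using hb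
    · have := mul_pos hs' ha
      have := mul_nonneg ht hb.le
      linarith
  · rintro _ ⟨z, ⟨hzb, hz⟩, rfl⟩ ⟨t, ht⟩
    by_cases htb : t ∈ Metric.ball t₀ δ
    · have h1 := him t htb
      rw [ht, φ.right_inv (hball hzb).1] at h1
      simp [h1] at hz
    · exact (hball hzb).2 ⟨t, htb, ht⟩
  · filter_upwards [Metric.ball_mem_nhds t₀ hδ,
      h.continuous.continuousAt.preimage_mem_nhds (hUopen.mem_nhds hUmem)] with t htδ htU
    have hline : HasDerivAt (fun ε : ℝ => w t + ε * (σ * Complex.I * f (w t)))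
        (σ * Complex.I * f (w t)) 0 := by
      have := ((Complex.ofRealCLM.hasDerivAt (x := (0 : ℝ))).mul_const
        (σ * Complex.I * f (w t))).const_add (w t)
      simpa using this
    have hstart : w t + ((0 : ℝ) : ℂ) * (σ * Complex.I * f (w t)) = w t := by simp
    have hmem : ∀ᶠ ε : ℝ in 𝓝 0, w t + ε * (σ * Complex.I * f (w t)) ∈
        φ.source ∩ φ ⁻¹' Metric.ball z₀ r :=
      hline.continuousAt.preimage_mem_nhds (by rw [hstart]; exact hUopen.mem_nhds htU)
    -- The normal vector `σ i f` becomes `σ i` in the chart, so the signed height grows at rate `σ²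
    -- > 0`.
    have hder : HasDerivAt (fun ε : ℝ => σ * (φ (w t + ε * (σ * Complex.I * f (w t)))).im)
        (σ * σ) 0 := by
      have h0 := hφ (w t) htU.1
      rw [← hstart] at h0
      have h1 := HasDerivAt.scomp (0 : ℝ) h0 hline
      have h2 : (σ * Complex.I * f (w t)) •
          (f (w t + ((0 : ℝ) : ℂ) * (σ * Complex.I * f (w t))))⁻¹ = σ * Complex.I := by
        rw [hstart, smul_eq_mul, mul_assoc, mul_inv_cancel₀ (h.ne_zero t), mul_one]
      rw [h2] at h1
      have h3 := (Complex.imCLM.hasFDerivAt.comp_hasDerivAt (0 : ℝ) h1).const_mul σ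
      simpa using h3
    have hpos : ∀ᶠ ε : ℝ in 𝓝[>] 0,
        0 < σ * (φ (w t + ε * (σ * Complex.I * f (w t)))).im - σ * z₀.im := by
      have hslope := (hasDerivAt_iff_tendsto_slope.1 hder).mono_left
        (nhdsWithin_mono (0 : ℝ) (fun x (hx : 0 < x) => hx.ne'))
      filter_upwards [hslope.eventually (lt_mem_nhds (mul_self_pos.2 hσ)),
        self_mem_nhdsWithin] with ε hε hε0
      rw [slope_def_field, hstart, him t htδ, sub_zero] at hε
      exact (div_pos_iff_of_pos_right hε0).1 hε
    filter_upwards [hpos, nhdsWithin_le_nhds hmem] with ε h1 h2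
    refine ⟨φ _, ⟨h2.2, ?_⟩, φ.left_inv h2.1⟩
    simpa [mul_sub] using h1
  · obtain ⟨y, hyU, hyV⟩ := mem_closure_iff.1 hcl _ hUopen hUmem
    have hO : IsOpen (φ '' (V ∩ (φ.source ∩ φ ⁻¹' Metric.ball z₀ r))) :=
      φ.isOpen_image_of_subset_source (hV.inter hUopen) fun y hy => hy.2.1
    -- A nonempty open set is not contained in a horizontal line.
    have hkey : ∃ z ∈ φ '' (V ∩ (φ.source ∩ φ ⁻¹' Metric.ball z₀ r)), z.im ≠ z₀.im := by
      by_cases hne : (φ y).im = z₀.im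
      · obtain ⟨s, hs, hsb⟩ := Metric.mem_nhds_iff.1 (hO.mem_nhds (mem_image_of_mem φ ⟨hyV, hyU⟩))
        refine ⟨φ y + (s / 2 : ℝ) * Complex.I, hsb ?_, ?_⟩
        · simp [abs_of_pos hs, hs]
        · simp [hne, hs.ne']
      · exact ⟨_, mem_image_of_mem φ ⟨hyV, hyU⟩, hne⟩
    obtain ⟨_, ⟨x, ⟨hxV, hxU⟩, rfl⟩, hx⟩ := hkey
    rcases hx.lt_or_gt with hx | hx
    · exact Or.inr ⟨x, hxV, φ x, ⟨hxU.2, by simpa using hx⟩, φ.left_inv hxU.1⟩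
    · exact Or.inl ⟨x, hxV, φ x, ⟨hxU.2, by simpa using hx⟩, φ.left_inv hxU.1⟩

/-- If a normal germ of the trajectory starts in a component of the complement, then it does so
at every time. -/
theorem germ_mem_component (h : IsProperOrbit f ρ w) (hf : Differentiable ℂ f) {σ : ℝ}
    (hσ : σ ≠ 0) (p : ℂ) {t₀ : ℝ}
    (ht₀ : ∀ᶠ ε : ℝ in 𝓝[>] 0, w t₀ + ε * (σ * Complex.I * f (w t₀)) ∈
      connectedComponentIn (range w)ᶜ p) (t₁ : ℝ) :
    ∀ᶠ ε : ℝ in 𝓝[>] 0, w t₁ + ε * (σ * Complex.I * f (w t₁)) ∈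
      connectedComponentIn (range w)ᶜ p := by
  set P : ℝ → Prop := fun t => ∀ᶠ ε : ℝ in 𝓝[>] 0, w t + ε * (σ * Complex.I * f (w t)) ∈
      connectedComponentIn (range w)ᶜ p
  -- Within one flow box the germs at nearby times lie in the same connected side; connectedness of
  -- the time axis chains these boxes.
  refine isPreconnected_univ.induction₂' (fun a b => P a → P b) (fun s _ => ?_)
    (fun a b c _ _ _ hab hbc => hbc ∘ hab) (mem_univ t₀) (mem_univ t₁) ht₀
  obtain ⟨S, hS, hSK, hgerm, -⟩ := h.exists_sides hf s
  rw [nhdsWithin_univ]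
  have key : ∀ a b, (∀ᶠ ε : ℝ in 𝓝[>] 0, w a + ε * (σ * Complex.I * f (w a)) ∈ S σ) →
      (∀ᶠ ε : ℝ in 𝓝[>] 0, w b + ε * (σ * Complex.I * f (w b)) ∈ S σ) → P a → P b := by
    intro a b ha hb hPa
    obtain ⟨ε, h1, h2⟩ := (ha.and hPa).exists
    filter_upwards [hb] with ε' hε'
    have := (hS σ).subset_connectedComponentIn h1 (hSK σ) hε'
    rwa [← connectedComponentIn_eq h2] at this
  filter_upwards [hgerm σ hσ] with t ht
  exact ⟨key s t (hgerm σ hσ).self_of_nhds ht, key t s ht (hgerm σ hσ).self_of_nhds⟩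

/-- Otherwise the component would be clopen in the plane, hence everything. -/
theorem exists_range_mem_closure_component (h : IsProperOrbit f ρ w) {p : ℂ} (hp : p ∉ range w) :
    ∃ t, w t ∈ closure (connectedComponentIn (range w)ᶜ p) := by
  set C := connectedComponentIn (range w)ᶜ p with hC
  have hKo : IsOpen (range w)ᶜ := h.isClosed_range.isOpen_compl
  have hCo : IsOpen C := hKo.connectedComponentIn
  have hCn : C.Nonempty := ⟨p, mem_connectedComponentIn hp⟩
  by_contra! hno
  have hclosed : IsClosed C := by
    refine isClosed_of_closure_subset fun x hx => ?_
    have hxK : x ∈ (range w)ᶜ := by rintro ⟨t, rfl⟩; exact hno t hx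
    obtain ⟨y, hy1, hy2⟩ := mem_closure_iff.1 hx _ (hKo.connectedComponentIn (x := x))
      (mem_connectedComponentIn hxK)
    rw [hC, connectedComponentIn_eq hy2, ← connectedComponentIn_eq hy1]
    exact mem_connectedComponentIn hxK
  have huniv : C = univ := IsClopen.eq_univ ⟨hclosed, hCo⟩ hCn
  exact connectedComponentIn_subset _ _ (huniv ▸ mem_univ (w 0) : w 0 ∈ C) ⟨0, rfl⟩

/-- Every component reaches the orbit somewhere, and its germ there can be transported to time `0`.
Components are thus labelled by two signs, which bounds their number. -/
theorem exists_germ_mem_component (h : IsProperOrbit f ρ w) (hf : Differentiable ℂ f) {p : ℂ}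
    (hp : p ∉ range w) :
    ∃ σ : ℝ, (σ = 1 ∨ σ = -1) ∧ ∀ᶠ ε : ℝ in 𝓝[>] 0, w 0 + ε * (σ * Complex.I * f (w 0)) ∈
      connectedComponentIn (range w)ᶜ p := by
  obtain ⟨t, ht⟩ := h.exists_range_mem_closure_component hp
  obtain ⟨S, hS, hSK, hgerm, hmeet⟩ := h.exists_sides hf t
  have key : ∀ σ, σ ≠ 0 → (connectedComponentIn (range w)ᶜ p ∩ S σ).Nonempty →
      ∀ᶠ ε : ℝ in 𝓝[>] 0, w 0 + ε * (σ * Complex.I * f (w 0)) ∈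
        connectedComponentIn (range w)ᶜ p := by
    rintro σ hσ ⟨y, hy1, hy2⟩
    refine h.germ_mem_component hf hσ p (t₀ := t) ?_ 0
    filter_upwards [(hgerm σ hσ).self_of_nhds] with ε hε
    rw [connectedComponentIn_eq hy1]
    exact (hS σ).subset_connectedComponentIn hy2 (hSK σ) hε
  rcases hmeet _ h.isClosed_range.isOpen_compl.connectedComponentIn ht with h1 | h1
  · exact ⟨1, Or.inl rfl, key 1 one_ne_zero h1⟩
  · exact ⟨-1, Or.inr rfl, key (-1) (by norm_num) h1⟩

/-- The complement of a proper orbit has at most two connected components. -/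
theorem mem_component_of_notMem (h : IsProperOrbit f ρ w) (hf : Differentiable ℂ f) {o p q : ℂ}
    (ho : o ∉ range w) (hp : p ∉ range w) (hq : q ∉ range w)
    (hpo : p ∉ connectedComponentIn (range w)ᶜ o) (hqo : q ∉ connectedComponentIn (range w)ᶜ o) :
    q ∈ connectedComponentIn (range w)ᶜ p := by
  have key : ∀ (σ : ℝ) {x y : ℂ}, y ∉ range w →
      (∀ᶠ ε : ℝ in 𝓝[>] 0, w 0 + ε * (σ * Complex.I * f (w 0)) ∈
        connectedComponentIn (range w)ᶜ x) →
      (∀ᶠ ε : ℝ in 𝓝[>] 0, w 0 + ε * (σ * Complex.I * f (w 0)) ∈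
        connectedComponentIn (range w)ᶜ y) → y ∈ connectedComponentIn (range w)ᶜ x := by
    intro σ x y hy h1 h2
    obtain ⟨ε, h1, h2⟩ := (h1.and h2).exists
    rw [connectedComponentIn_eq h1, ← connectedComponentIn_eq h2]
    exact mem_connectedComponentIn hy
  obtain ⟨σo, so, go⟩ := h.exists_germ_mem_component hf ho
  obtain ⟨σp, sp, gp⟩ := h.exists_germ_mem_component hf hp
  obtain ⟨σq, sq, gq⟩ := h.exists_germ_mem_component hf hq
  by_cases h1 : σp = σo
  · exact absurd (key σo hp go (h1 ▸ gp)) hpo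
  by_cases h2 : σq = σo
  · exact absurd (key σo hq go (h2 ▸ gq)) hqo
  -- Pigeonhole: both signs differ from `σo`, and only two signs exist.
  have h3 : σq = σp := by
    rcases so with rfl | rfl <;> rcases sp with rfl | rfl <;> rcases sq with rfl | rfl <;>
      simp_all
  exact key σp hq gp (h3 ▸ gq)

end IsProperOrbit

/-! ### Improper integrals as increments of primitives. -/

/-- The improper integral of `g` over the real line, understood as the difference of the limits
of a primitive at `±∞`, equals `z`. -/
def HasIncrement (g : ℝ → ℂ) (z : ℂ) : Prop :=
  ∃ (L : ℝ → ℂ) (a b : ℂ), (∀ t, HasDerivAt L (g t) t) ∧ Tendsto L atBot (𝓝 a) ∧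
    Tendsto L atTop (𝓝 b) ∧ b - a = z

theorem HasIncrement.add {g₁ g₂ : ℝ → ℂ} {z₁ z₂ : ℂ} (h₁ : HasIncrement g₁ z₁)
    (h₂ : HasIncrement g₂ z₂) : HasIncrement (fun t => g₁ t + g₂ t) (z₁ + z₂) := by
  obtain ⟨L₁, a₁, b₁, hL₁, ha₁, hb₁, rfl⟩ := h₁
  obtain ⟨L₂, a₂, b₂, hL₂, ha₂, hb₂, rfl⟩ := h₂
  exact ⟨fun t => L₁ t + L₂ t, a₁ + a₂, b₁ + b₂, fun t => (hL₁ t).add (hL₂ t), ha₁.add ha₂,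
    hb₁.add hb₂, by ring⟩

theorem HasIncrement.const_mul {g : ℝ → ℂ} {z : ℂ} (c : ℂ) (h : HasIncrement g z) :
    HasIncrement (fun t => c * g t) (c * z) := by
  obtain ⟨L, a, b, hL, ha, hb, rfl⟩ := h
  exact ⟨fun t => c * L t, c * a, c * b, fun t => (hL t).const_mul c, ha.const_mul c,
    hb.const_mul c, by ring⟩

theorem HasIncrement.sum {ι : Type*} (s : Finset ι) {g : ι → ℝ → ℂ} {z : ι → ℂ}
    (h : ∀ j ∈ s, HasIncrement (g j) (z j)) :
    HasIncrement (fun t => ∑ j ∈ s, g j t) (∑ j ∈ s, z j) := by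
  classical
  induction s using Finset.induction_on with
  | empty =>
    exact ⟨fun _ => 0, 0, 0, fun t => by simpa using hasDerivAt_const t (0 : ℂ),
      tendsto_const_nhds, tendsto_const_nhds, by simp⟩
  | insert j s hj ih =>
    simp only [Finset.sum_insert hj]
    exact (h j (Finset.mem_insert_self _ _)).add
      (ih fun k hk => h k (Finset.mem_insert_of_mem hk))

/-- The improper integral of a positive real function is a positive real number. -/
theorem HasIncrement.pos {ρ : ℝ → ℝ} {z : ℂ} (h : HasIncrement (fun t => (ρ t : ℂ)) z)
    (hρ : ∀ t, 0 < ρ t) : 0 < z.re ∧ z.im = 0 := by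
  obtain ⟨L, a, b, hL, ha, hb, rfl⟩ := h
  have hre : ∀ t, HasDerivAt (fun t => (L t).re) (ρ t) t := fun t => by
    have := Complex.reCLM.hasFDerivAt.comp_hasDerivAt t (hL t)
    rwa [Complex.reCLM_apply, Complex.ofReal_re] at this
  have him : ∀ t, HasDerivAt (fun t => (L t).im) 0 t := fun t => by
    have := Complex.imCLM.hasFDerivAt.comp_hasDerivAt t (hL t)
    rwa [Complex.imCLM_apply, Complex.ofReal_im] at this
  have hmono : StrictMono fun t => (L t).re := strictMono_of_hasDerivAt_pos hre hρ
  have h0 : a.re ≤ (L 0).re :=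
    hmono.monotone.le_of_tendsto ((Complex.continuous_re.tendsto a).comp ha) 0
  have h1 : (L 1).re ≤ b.re :=
    hmono.monotone.ge_of_tendsto ((Complex.continuous_re.tendsto b).comp hb) 1
  have h01 : (L 0).re < (L 1).re := hmono one_pos
  have hconst : (fun t => (L t).im) = fun _ => (L 0).im := funext fun t =>
    is_const_of_deriv_eq_zero (fun t => (him t).differentiableAt) (fun t => (him t).deriv) t 0
  have ha' : a.im = (L 0).im := tendsto_nhds_unique
    (((Complex.continuous_im.tendsto a).comp ha).congr (congrFun hconst)) tendsto_const_nhds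
  have hb' : b.im = (L 0).im := tendsto_nhds_unique
    (((Complex.continuous_im.tendsto b).comp hb).congr (congrFun hconst)) tendsto_const_nhds
  exact ⟨by rw [Complex.sub_re]; linarith, by rw [Complex.sub_im, ha', hb', sub_self]⟩

/-! ### Logarithmic increments of curves closed at infinity. -/

section LogDeriv

variable {h h' L : ℝ → ℂ}

/-- On a set of times where `h` stays in the slit plane, a continuous logarithm of `h` differs
from the principal one by a constant. -/
theorem sub_log_eq_of_mem_slitPlane {s : Set ℝ} (hs : Convex ℝ s) (hso : IsOpen s)
    (hh : ∀ t, HasDerivAt h (h' t) t) (hL : ∀ t, HasDerivAt L (h' t / h t) t)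
    (hslit : ∀ t ∈ s, h t ∈ Complex.slitPlane) {t₀ t : ℝ} (ht₀ : t₀ ∈ s) (ht : t ∈ s) :
    L t - Complex.log (h t) = L t₀ - Complex.log (h t₀) := by
  have hd : ∀ t ∈ s, HasDerivAt (fun t => L t - Complex.log (h t)) 0 t := fun t ht => by
    have := (hL t).sub ((hh t).clog_real (hslit t ht))
    rwa [sub_self] at this
  refine hs.is_const_of_fderivWithin_eq_zero (𝕜 := ℝ) (f := fun t => L t - Complex.log (h t))
    (fun x hx => (hd x hx).differentiableAt.differentiableWithinAt) (fun x hx => ?_) ht ht₀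
  rw [fderivWithin_of_isOpen hso hx, (hd x hx).hasFDerivAt.fderiv]
  simp

/-- Near the limit `1` the principal logarithm controls `L` up to a constant. The formula for `exp
c` comes from constancy of `exp L / h`; its right side refers only to time `0`, so the two ends can
be compared. -/
theorem exists_tendsto_log_atTop (hh : ∀ t, HasDerivAt h (h' t) t) (hne : ∀ t, h t ≠ 0)
    (hL : ∀ t, HasDerivAt L (h' t / h t) t) (hlim : Tendsto h atTop (𝓝 1)) :
    ∃ c, Tendsto L atTop (𝓝 c) ∧ Complex.exp c = Complex.exp (L 0) / h 0 := by
  have hslit : ∀ᶠ t in atTop, h t ∈ Complex.slitPlane :=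
    hlim.eventually (Complex.isOpen_slitPlane.mem_nhds Complex.one_mem_slitPlane)
  obtain ⟨M, hM⟩ := eventually_atTop.1 hslit
  set c := L (M + 1) - Complex.log (h (M + 1)) with hc
  have hlog : Tendsto (fun t => c + Complex.log (h t)) atTop (𝓝 c) := by
    have := ((continuousAt_clog Complex.one_mem_slitPlane).tendsto.comp hlim).const_add c
    simpa using this
  have hLc : Tendsto L atTop (𝓝 c) := by
    refine hlog.congr' ?_
    filter_upwards [eventually_gt_atTop M] with t ht
    have := sub_log_eq_of_mem_slitPlane (convex_Ioi M) isOpen_Ioi hh hL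
      (fun t ht => hM t (le_of_lt ht)) (t₀ := M + 1) (t := t) (lt_add_one M) ht
    rw [hc, ← this]
    ring
  refine ⟨c, hLc, ?_⟩
  have hd : ∀ t, HasDerivAt (fun t => Complex.exp (L t) / h t) 0 t := fun t => by
    refine ((hL t).cexp.div (hh t) (hne t)).congr_deriv ?_
    rw [mul_assoc, div_mul_cancel₀ _ (hne t), sub_self, zero_div]
  have hconst : ∀ t, Complex.exp (L t) / h t = Complex.exp (L 0) / h 0 := fun t =>
    is_const_of_deriv_eq_zero (fun t => (hd t).differentiableAt) (fun t => (hd t).deriv) t 0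
  have hexp : Tendsto (fun t => Complex.exp (L t) / h t) atTop (𝓝 (Complex.exp c / 1)) :=
    ((Complex.continuous_exp.tendsto c).comp hLc).div hlim one_ne_zero
  rw [div_one] at hexp
  exact tendsto_nhds_unique hexp (tendsto_const_nhds.congr fun t => (hconst t).symm)

theorem exists_tendsto_log_atBot (hh : ∀ t, HasDerivAt h (h' t) t) (hne : ∀ t, h t ≠ 0)
    (hL : ∀ t, HasDerivAt L (h' t / h t) t) (hlim : Tendsto h atBot (𝓝 1)) :
    ∃ c, Tendsto L atBot (𝓝 c) ∧ Complex.exp c = Complex.exp (L 0) / h 0 := by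
  have hn : ∀ {g g' : ℝ → ℂ}, (∀ t, HasDerivAt g (g' t) t) →
      ∀ t, HasDerivAt (fun t => g (-t)) (-g' (-t)) t := fun {g g'} hg t => by
    have := (hg (-t)).scomp t (hasDerivAt_neg t)
    rwa [neg_smul, one_smul] at this
  -- Time reversal, which fixes the reference time `0`.
  obtain ⟨c, hc, hc'⟩ := exists_tendsto_log_atTop (h := fun t => h (-t)) (L := fun t => L (-t))
    (h' := fun t => -h' (-t)) (hn hh) (fun t => hne (-t))
    (fun t => by simpa [neg_div] using hn hL t) (hlim.comp tendsto_neg_atTop_atBot)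
  refine ⟨c, ?_, by simpa using hc'⟩
  simpa [Function.comp_def] using hc.comp tendsto_neg_atBot_atTop

/-- The logarithmic increment of a nowhere vanishing curve which is closed at infinity is
imaginary. -/
theorem exists_hasIncrement_logDeriv (hh : ∀ t, HasDerivAt h (h' t) t) (hne : ∀ t, h t ≠ 0)
    (hcont : Continuous h') (hbot : Tendsto h atBot (𝓝 1)) (htop : Tendsto h atTop (𝓝 1)) :
    ∃ z, HasIncrement (fun t => h' t / h t) z ∧ z.re = 0 := by
  have hhc : Continuous h := continuous_iff_continuousAt.2 fun t => (hh t).continuousAt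
  have hL : ∀ t, HasDerivAt (fun u => ∫ s in (0 : ℝ)..u, h' s / h s) (h' t / h t) t := fun t =>
    ((hcont.div hhc hne).integral_hasStrictDerivAt 0 t).hasDerivAt
  obtain ⟨a, ha, ha'⟩ := exists_tendsto_log_atBot hh hne hL hbot
  obtain ⟨b, hb, hb'⟩ := exists_tendsto_log_atTop hh hne hL htop
  refine ⟨b - a, ⟨_, a, b, hL, ha, hb, rfl⟩, ?_⟩
  have hexp : Complex.exp (b - a) = 1 := by
    rw [Complex.exp_sub, hb', ← ha', div_self (Complex.exp_ne_zero a)]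
  have := congrArg norm hexp
  rwa [Complex.norm_exp, norm_one, Real.exp_eq_one_iff] at this

theorem hasIncrement_logDeriv_of_mem_slitPlane (hh : ∀ t, HasDerivAt h (h' t) t)
    (hslit : ∀ t, h t ∈ Complex.slitPlane) (hbot : Tendsto h atBot (𝓝 1))
    (htop : Tendsto h atTop (𝓝 1)) : HasIncrement (fun t => h' t / h t) 0 := by
  have hlog : Tendsto Complex.log (𝓝 1) (𝓝 0) := by
    simpa using (continuousAt_clog Complex.one_mem_slitPlane).tendsto
  exact ⟨fun t => Complex.log (h t), 0, 0, fun t => (hh t).clog_real (hslit t),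
    hlog.comp hbot, hlog.comp htop, sub_self 0⟩

end LogDeriv

/-! ### Relative winding numbers of a proper orbit. -/

/-- The integrand of the winding number of the curve `w` around `p` relative to `q`. -/
noncomputable def windingKernel (f : ℂ → ℂ) (ρ : ℝ → ℝ) (w : ℝ → ℂ) (p q : ℂ) (t : ℝ) : ℂ :=
  ρ t * f (w t) * ((w t - p)⁻¹ - (w t - q)⁻¹)

theorem windingKernel_add_windingKernel (f : ℂ → ℂ) (ρ : ℝ → ℝ) (w : ℝ → ℂ) (p q r : ℂ) :
    (fun t => windingKernel f ρ w p q t + windingKernel f ρ w q r t) =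
      windingKernel f ρ w p r := by
  funext t
  simp only [windingKernel]
  ring

theorem windingKernel_swap (f : ℂ → ℂ) (ρ : ℝ → ℝ) (w : ℝ → ℂ) (p q : ℂ) :
    (fun t => -1 * windingKernel f ρ w p q t) = windingKernel f ρ w q p := by
  funext t
  simp only [windingKernel]
  ring

namespace IsProperOrbit

variable {f : ℂ → ℂ} {ρ : ℝ → ℝ} {w : ℝ → ℂ} {p q : ℂ}

theorem sub_ne_zero_of_notMem (hp : p ∉ range w) (t : ℝ) : w t - p ≠ 0 :=
  sub_ne_zero.2 fun ht => hp ⟨t, ht⟩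

theorem tendsto_ratio {l : Filter ℝ} (hl : Tendsto (fun t => ‖w t‖) l atTop) (hq : q ∉ range w) :
    Tendsto (fun t => (w t - p) / (w t - q)) l (𝓝 1) := by
  have hinv : Tendsto (fun t => (w t - q)⁻¹) l (𝓝 0) := by
    rw [tendsto_zero_iff_norm_tendsto_zero]
    simp only [norm_inv]
    refine tendsto_inv_atTop_zero.comp (tendsto_atTop_mono (fun t => norm_sub_norm_le _ _)
      (tendsto_atTop_add_const_right _ (-‖q‖) hl))
  have h1 : Tendsto (fun t => 1 + (q - p) * (w t - q)⁻¹) l (𝓝 1) := by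
    simpa using (hinv.const_mul (q - p)).const_add 1
  refine h1.congr fun t => ?_
  have := sub_ne_zero_of_notMem hq t
  field_simp
  ring

theorem hasDerivAt_ratio (h : IsProperOrbit f ρ w) (hq : q ∉ range w) (t : ℝ) :
    HasDerivAt (fun t => (w t - p) / (w t - q))
      (ρ t * f (w t) * (p - q) / (w t - q) ^ 2) t := by
  refine (((h.hasDerivAt t).sub_const p).div ((h.hasDerivAt t).sub_const q)
    (sub_ne_zero_of_notMem hq t)).congr_deriv ?_
  ring

theorem windingKernel_eq (hp : p ∉ range w) (hq : q ∉ range w) :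
    windingKernel f ρ w p q = fun t =>
      (ρ t * f (w t) * (p - q) / (w t - q) ^ 2) / ((w t - p) / (w t - q)) := by
  funext t
  have h1 := sub_ne_zero_of_notMem hp t
  have h2 := sub_ne_zero_of_notMem hq t
  simp only [windingKernel]
  field_simp
  ring

theorem exists_hasIncrement_windingKernel (h : IsProperOrbit f ρ w) (hf : Continuous f)
    (hp : p ∉ range w) (hq : q ∉ range w) :
    ∃ z, HasIncrement (windingKernel f ρ w p q) z ∧ z.re = 0 := by
  rw [windingKernel_eq hp hq]
  refine exists_hasIncrement_logDeriv (h.hasDerivAt_ratio hq)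
    (fun t => div_ne_zero (sub_ne_zero_of_notMem hp t) (sub_ne_zero_of_notMem hq t)) ?_
    (tendsto_ratio h.tendsto_atBot hq) (tendsto_ratio h.tendsto_atTop hq)
  have := h.continuous
  exact (((Complex.continuous_ofReal.comp h.continuous_rate).mul (hf.comp this)).mul
    continuous_const).div ((this.sub continuous_const).pow 2)
    fun t => pow_ne_zero 2 (sub_ne_zero_of_notMem hq t)

/-- The ratio `(w - p)/(w - q)` stays in the unit disk around `1`, where the principal logarithm is
a global primitive vanishing at both ends. -/
theorem hasIncrement_windingKernel_of_dist_lt (h : IsProperOrbit f ρ w)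
    {r : ℝ} (hr : Metric.ball q r ⊆ (range w)ᶜ) (hp : dist p q < r) :
    HasIncrement (windingKernel f ρ w p q) 0 := by
  have hpK : p ∉ range w := hr hp
  have hqK : q ∉ range w := hr (Metric.mem_ball_self (dist_nonneg.trans_lt hp))
  rw [windingKernel_eq hpK hqK]
  refine hasIncrement_logDeriv_of_mem_slitPlane (h.hasDerivAt_ratio hqK) (fun t => ?_)
    (tendsto_ratio h.tendsto_atBot hqK) (tendsto_ratio h.tendsto_atTop hqK)
  have h2 := sub_ne_zero_of_notMem hqK t
  have hrt : r ≤ ‖w t - q‖ := by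
    by_contra! hlt
    exact hr (show w t ∈ Metric.ball q r by rwa [Metric.mem_ball, dist_eq_norm]) ⟨t, rfl⟩
  have heq : (w t - p) / (w t - q) = 1 + (q - p) / (w t - q) := by
    field_simp
    ring
  rw [heq]
  refine Complex.mem_slitPlane_of_norm_lt_one ?_
  rw [norm_div, div_lt_one (norm_pos_iff.2 h2), ← dist_eq_norm, dist_comm]
  exact hp.trans_le hrt

/-- The winding number is constant on the components of the complement. -/
theorem hasIncrement_windingKernel_of_mem_component (h : IsProperOrbit f ρ w)
    (hp : p ∈ connectedComponentIn (range w)ᶜ q) : HasIncrement (windingKernel f ρ w p q) 0 := by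
  have hsymm : ∀ {x y}, HasIncrement (windingKernel f ρ w x y) 0 →
      HasIncrement (windingKernel f ρ w y x) 0 := fun {x y} hxy => by
    have := hxy.const_mul (-1)
    rwa [windingKernel_swap, mul_zero] at this
  have hq : q ∈ (range w)ᶜ := connectedComponentIn_nonempty_iff.1 ⟨p, hp⟩
  refine isPreconnected_connectedComponentIn.induction₂'
    (fun x y => HasIncrement (windingKernel f ρ w x y) 0) (fun x hx => ?_)
    (fun x y z _ _ _ hxy hyz => ?_) hp (mem_connectedComponentIn hq)
  · obtain ⟨r, hr, hball⟩ := Metric.isOpen_iff.1 h.isClosed_range.isOpen_compl x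
      (connectedComponentIn_subset _ _ hx)
    filter_upwards [nhdsWithin_le_nhds (Metric.ball_mem_nhds x hr)] with y hy
    have := h.hasIncrement_windingKernel_of_dist_lt hball hy
    exact ⟨hsymm this, this⟩
  · have := hxy.add hyz
    rwa [windingKernel_add_windingKernel, add_zero] at this

end IsProperOrbit

/-! ### Partial fractions of `1/f` by Lagrange interpolation. -/

section PartialFractions

variable {d : ℕ} {e : Fin d → ℂ}

theorem eval_poly (e : Fin d → ℂ) (x : ℂ) : (poly e).eval x = ∏ j, (x - e j) := by
  simp [poly, Polynomial.eval_prod]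

theorem eval_poly_eq_zero (e : Fin d → ℂ) (j : Fin d) : (poly e).eval (e j) = 0 := by
  rw [eval_poly]
  exact Finset.prod_eq_zero (Finset.mem_univ j) (sub_self _)

theorem poly_eq_nodal (e : Fin d → ℂ) : poly e = Lagrange.nodal Finset.univ e :=
  (Lagrange.nodal_eq _ _).symm

theorem eta_eq_nodalWeight (e : Fin d → ℂ) (j : Fin d) :
    eta e j = Lagrange.nodalWeight Finset.univ e j := by
  rw [eta, poly_eq_nodal, Lagrange.nodalWeight_eq_eval_derivative_nodal (Finset.mem_univ j),
    one_div]

/-- This is the barycentric interpolation formula, exact in degree below `d`, whose weights are the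
`η_j`. -/
theorem eval_eq_eval_poly_mul_sum (he : Function.Injective e) {P : Polynomial ℂ}
    (hP : P.degree < d) {x : ℂ} (hx : ∀ j, x ≠ e j) :
    P.eval x = (poly e).eval x * ∑ j, eta e j * (x - e j)⁻¹ * P.eval (e j) := by
  have hdeg : P.degree < (Finset.univ : Finset (Fin d)).card := by simpa using hP
  have := Lagrange.eq_interpolate (v := e) he.injOn hdeg
  conv_lhs => rw [this]
  rw [Lagrange.eval_interpolate_not_at_node _ fun j _ => hx j, poly_eq_nodal]
  simp only [eta_eq_nodalWeight]

theorem eval_poly_mul_sum_eta_mul_inv (he : Function.Injective e) (hd : 0 < d) {x : ℂ}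
    (hx : ∀ j, x ≠ e j) : (poly e).eval x * ∑ j, eta e j * (x - e j)⁻¹ = 1 := by
  have := eval_eq_eval_poly_mul_sum he (P := 1)
    (by rw [Polynomial.degree_one]; exact_mod_cast hd) hx
  simpa using this.symm

theorem sum_eta_eq_zero (he : Function.Injective e) (hd : 2 ≤ d) : ∑ j, eta e j = 0 := by
  obtain ⟨x, hx⟩ := (finite_range e).exists_notMem
  have hx' : ∀ j, x ≠ e j := fun j hj => hx ⟨j, hj.symm⟩
  -- This `P` vanishes at `x` and cancels every factor `(x - e j)⁻¹`, leaving `-∑ η_j`; its degree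
  -- `1` is where `d ≥ 2` enters.
  have h := eval_eq_eval_poly_mul_sum he (P := Polynomial.X - Polynomial.C x)
    (by rw [Polynomial.degree_X_sub_C]; exact_mod_cast hd) hx'
  have hterm : ∀ j, eta e j * (x - e j)⁻¹ * (e j - x) = -eta e j := fun j => by
    have := sub_ne_zero.2 (hx' j)
    field_simp
    ring
  simp only [Polynomial.eval_sub, Polynomial.eval_X, Polynomial.eval_C, sub_self, hterm,
    Finset.sum_neg_distrib] at h
  have hne : (poly e).eval x ≠ 0 := by
    rw [eval_poly]
    exact Finset.prod_ne_zero_iff.2 fun j _ => sub_ne_zero.2 (hx' j)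
  simpa [hne] using h

end PartialFractions

/-! ### The residue identity for proper orbits. -/

/-- The residue identity for a proper orbit: the reciprocal linearizations on the opposite side
of the orbit sum up to a nonzero imaginary number. -/
theorem IsProperOrbit.sum_eta_re_eq_zero {d : ℕ} {e : Fin d → ℂ} {ρ : ℝ → ℝ} {w : ℝ → ℂ}
    (h : IsProperOrbit (fun x => (poly e).eval x) ρ w) (hd : 2 ≤ d) (he : Function.Injective e)
    (i : Fin d) {J : Finset (Fin d)}
    (hJ : ∀ j, j ∈ J ↔ e j ∉ connectedComponentIn (range w)ᶜ (e i)) :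
    J.Nonempty ∧ ∑ j ∈ J, (eta e j).re = 0 := by
  have hK : ∀ j, e j ∉ range w := by
    rintro j ⟨t, ht⟩
    exact h.ne_zero t (by simp only [ht, eval_poly_eq_zero])
  have hkernel : ∀ t, ∑ j, eta e j * windingKernel (fun x => (poly e).eval x) ρ w (e j) (e i) t
      = ρ t := by
    intro t
    have h1 := eval_poly_mul_sum_eta_mul_inv he (by omega) (x := w t)
      fun j hj => hK j ⟨t, hj⟩
    have h2 : ∀ j, eta e j * windingKernel (fun x => (poly e).eval x) ρ w (e j) (e i) t
        = ρ t * (poly e).eval (w t) * (eta e j * (w t - e j)⁻¹)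
          - ρ t * (poly e).eval (w t) * (w t - e i)⁻¹ * eta e j := fun j => by
      simp only [windingKernel]
      ring
    simp only [h2]
    rw [Finset.sum_sub_distrib, ← Finset.mul_sum, ← Finset.mul_sum, sum_eta_eq_zero he hd,
      mul_assoc, h1]
    ring
  have hpos : ∀ z : Fin d → ℂ,
      (∀ j, HasIncrement (windingKernel (fun x => (poly e).eval x) ρ w (e j) (e i)) (z j)) →
      0 < (∑ j, eta e j * z j).re ∧ (∑ j, eta e j * z j).im = 0 := by
    intro z hz
    -- Convergence of `∫ ρ dt` is inherited from the kernels.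
    have := HasIncrement.sum Finset.univ fun j _ => (hz j).const_mul (eta e j)
    simp only [hkernel] at this
    exact this.pos h.pos
  have hside : ∀ j, j ∉ J →
      HasIncrement (windingKernel (fun x => (poly e).eval x) ρ w (e j) (e i)) 0 := fun j hj =>
    h.hasIncrement_windingKernel_of_mem_component (by simpa [hJ] using hj)
  have hne : J.Nonempty := by
    by_contra hempty
    rw [Finset.not_nonempty_iff_eq_empty] at hempty
    have := hpos 0 fun j => hside j (by simp [hempty])
    simp at this
  obtain ⟨k, hk⟩ := hne
  refine ⟨⟨k, hk⟩, ?_⟩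
  obtain ⟨z, hz, hzre⟩ := h.exists_hasIncrement_windingKernel (poly e).continuous (hK k) (hK i)
  have hJz : ∀ j ∈ J,
      HasIncrement (windingKernel (fun x => (poly e).eval x) ρ w (e j) (e i)) z := by
    intro j hj
    have := (h.hasIncrement_windingKernel_of_mem_component
      (h.mem_component_of_notMem (poly e).differentiable (hK i) (hK k) (hK j)
        ((hJ k).1 hk) ((hJ j).1 hj))).add hz
    rwa [windingKernel_add_windingKernel, zero_add] at this
  -- With a single imaginary `z` on `J`, the vanishing imaginary part reads `Re(∑ η_j) * Im z = 0`;
  -- `Im z = 0` would contradict positivity.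
  have hsum := hpos (fun j => if j ∈ J then z else 0) fun j => by
    by_cases hj : j ∈ J
    · simpa [hj] using hJz j hj
    · simpa [hj] using hside j hj
  simp only [mul_ite, mul_zero, Finset.sum_ite_mem, Finset.univ_inter] at hsum
  rw [← Finset.sum_mul, Complex.mul_re, Complex.mul_im, hzre, mul_zero, mul_zero, add_zero,
    zero_sub, Complex.re_sum] at hsum
  rcases mul_eq_zero.1 hsum.2 with h0 | h0
  · exact h0
  · simp [h0] at hsum

/-! ### Passage from the hemisphere to the affine chart. -/

variable {d : ℕ} {e : Fin d → ℂ} {A B : ℂ × ℝ} {γ : ℝ → ℂ × ℝ}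

theorem toDisk_div_of_mem_openDisk {p : ℂ × ℝ} (hp : p ∈ openDisk) : toDisk (p.1 / p.2) = p := by
  obtain ⟨⟨h1, -⟩, hs⟩ := hp
  have hsC : (p.2 : ℂ) ≠ 0 := by exact_mod_cast hs.ne'
  have h2 : 1 + ‖p.1 / (p.2 : ℂ)‖ ^ 2 = (1 / p.2) ^ 2 := by
    rw [norm_div, Complex.norm_real, Real.norm_of_nonneg hs.le]
    field_simp
    linarith
  have h3 : Real.sqrt (1 + ‖p.1 / (p.2 : ℂ)‖ ^ 2) = 1 / p.2 := by
    rw [h2, Real.sqrt_sq (one_div_pos.2 hs).le]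
  refine Prod.ext ?_ ?_
  · simp only [toDisk, h3]
    push_cast
    field_simp
  · simp only [toDisk, h3, one_div_one_div]

theorem sqrt_one_add_norm_sq_pos (w : ℂ) : 0 < Real.sqrt (1 + ‖w‖ ^ 2) :=
  Real.sqrt_pos.2 (by positivity)

theorem toDisk_fst_div_snd (w : ℂ) : (toDisk w).1 / ((toDisk w).2 : ℂ) = w := by
  have : (Real.sqrt (1 + ‖w‖ ^ 2) : ℂ) ≠ 0 := by exact_mod_cast (sqrt_one_add_norm_sq_pos w).ne'
  simp only [toDisk]
  push_cast
  field_simp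

theorem toDisk_mem_openDisk (w : ℂ) : toDisk w ∈ openDisk := by
  have h := sqrt_one_add_norm_sq_pos w
  have hs : 0 < (toDisk w).2 := one_div_pos.2 h
  refine ⟨⟨?_, hs.le⟩, hs⟩
  simp only [toDisk]
  rw [norm_div, Complex.norm_real, Real.norm_of_nonneg h.le, div_pow, div_pow,
    Real.sq_sqrt (by positivity)]
  field_simp
  ring

theorem continuous_toDisk : Continuous toDisk := by
  have h : Continuous fun w : ℂ => Real.sqrt (1 + ‖w‖ ^ 2) := by fun_prop
  exact (continuous_id.div (Complex.continuous_ofReal.comp h) fun w =>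
    Complex.ofReal_ne_zero.2 (sqrt_one_add_norm_sq_pos w).ne').prodMk
    (continuous_const.div h fun w => (sqrt_one_add_norm_sq_pos w).ne')

theorem contDiff_compactField (e : Fin d → ℂ) : ContDiff ℝ 1 (compactField e) := by
  have hs : ContDiff ℝ 1 fun p : ℂ × ℝ => (p.2 : ℂ) := Complex.ofRealCLM.contDiff.comp contDiff_snd
  have hF : ContDiff ℝ 1 (homog e) :=
    contDiff_prod fun j _ => contDiff_fst.sub (contDiff_const.mul hs)
  have hr : ContDiff ℝ 1 fun p : ℂ × ℝ => ((starRingEnd ℂ) p.1 * homog e p).re :=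
    Complex.reCLM.contDiff.comp ((Complex.conjCLE.contDiff.comp contDiff_fst).mul hF)
  exact (hF.sub ((Complex.ofRealCLM.contDiff.comp hr).mul contDiff_fst)).prodMk
    (contDiff_snd.mul hr).neg

theorem closedDisk_subset_closedBall : closedDisk ⊆ Metric.closedBall (0 : ℂ × ℝ) 1 := by
  rintro p ⟨h1, h2⟩
  rw [mem_closedBall_zero_iff, Prod.norm_def, sup_le_iff, Real.norm_of_nonneg h2]
  constructor <;> nlinarith [norm_nonneg p.1, sq_nonneg p.2, sq_nonneg ‖p.1‖]

/-- Trajectories of the compactified flow are determined by their initial values. -/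
theorem trajectory_unique {γ₁ γ₂ : ℝ → ℂ × ℝ}
    (h₁ : ∀ t, HasDerivAt γ₁ (compactField e (γ₁ t)) t) (m₁ : ∀ t, γ₁ t ∈ closedDisk)
    (h₂ : ∀ t, HasDerivAt γ₂ (compactField e (γ₂ t)) t) (m₂ : ∀ t, γ₂ t ∈ closedDisk)
    {t₀ : ℝ} (h : γ₁ t₀ = γ₂ t₀) : γ₁ = γ₂ := by
  -- The polynomial field is only locally Lipschitz; a compact ball containing the hemisphere gives
  -- one constant for all times.
  have hlip : LocallyLipschitzOn (Metric.closedBall (0 : ℂ × ℝ) 1) (compactField e) :=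
    (contDiff_compactField e).locallyLipschitz.locallyLipschitzOn
  obtain ⟨K, hK⟩ := LocallyLipschitzOn.exists_lipschitzOnWith_of_compact
    (isCompact_closedBall (0 : ℂ × ℝ) 1) hlip
  exact ODE_solution_unique_univ (v := fun _ => compactField e) (s := fun _ => closedDisk)
    (fun _ => hK.mono closedDisk_subset_closedBall) (fun t => ⟨h₁ t, m₁ t⟩)
    (fun t => ⟨h₂ t, m₂ t⟩) h

namespace IsInteriorSaddleConnection

theorem snd_pos (hγ : IsInteriorSaddleConnection e A B γ) (t : ℝ) : 0 < (γ t).2 :=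
  (hγ.mem_openDisk t).2

theorem ne_target (hγ : IsInteriorSaddleConnection e A B γ) (t : ℝ) : γ t ≠ B := fun h =>
  (hγ.snd_pos t).ne' (h ▸ hγ.target_mem.1.2)

/-- A repeated value would make the orbit periodic, so convergence to `B` would force it to meet
`B`, which lies outside the open disk. -/
theorem injective (hγ : IsInteriorSaddleConnection e A B γ) : Function.Injective γ := by
  have key : ∀ a b, a < b → γ a ≠ γ b := by
    intro a b hab heq
    have hper : Function.Periodic γ (b - a) := by
      have := trajectory_unique (e := e) (γ₁ := fun t => γ (t + (b - a))) (γ₂ := γ)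
        (fun t => HasDerivAt.comp_add_const t (b - a) (hγ.orbit _))
        (fun t => (hγ.mem_openDisk _).1) hγ.orbit
        (fun t => (hγ.mem_openDisk t).1) (t₀ := a) (by simp [heq])
      exact congrFun this
    have hlim : Tendsto (fun n : ℕ => γ (a + n * (b - a))) atTop (𝓝 B) :=
      hγ.tendsto_target.comp (tendsto_atTop_add_const_left _ _
        (tendsto_natCast_atTop_atTop.atTop_mul_const (sub_pos.2 hab)))
    refine hγ.ne_target a (tendsto_nhds_unique (tendsto_const_nhds.congr fun n => ?_) hlim)
    exact (hper.nat_mul n a).symm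
  intro a b hab
  by_contra hne
  rcases lt_or_gt_of_ne hne with h | h
  · exact key a b h hab
  · exact key b a h hab.symm

theorem compactField_ne_zero (hγ : IsInteriorSaddleConnection e A B γ) (t : ℝ) :
    compactField e (γ t) ≠ 0 := by
  intro h0
  have := trajectory_unique (e := e) (γ₁ := γ) (γ₂ := fun _ => γ t) hγ.orbit
    (fun t => (hγ.mem_openDisk t).1) (fun s => by rw [h0]; exact hasDerivAt_const s (γ t))
    (fun _ => (hγ.mem_openDisk t).1) (t₀ := t) rfl
  exact (lt_add_one t).ne' (hγ.injective (congrFun this (t + 1)))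

theorem tendsto_norm_div {l : Filter ℝ} {C : ℂ × ℝ} (hγ : IsInteriorSaddleConnection e A B γ)
    (hC : C ∈ boundaryCircle) (hl : Tendsto γ l (𝓝 C)) :
    Tendsto (fun t => ‖(γ t).1 / ((γ t).2 : ℂ)‖) l atTop := by
  obtain ⟨⟨h1, -⟩, h2⟩ := hC
  have hs : Tendsto (fun t => (γ t).2) l (𝓝[>] 0) :=
    tendsto_nhdsWithin_iff.2 ⟨h2 ▸ (continuous_snd.tendsto C).comp hl,
      Eventually.of_forall hγ.snd_pos⟩
  have hx : Tendsto (fun t => ‖(γ t).1‖) l (𝓝 ‖C.1‖) := (continuous_fst.norm.tendsto C).comp hl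
  have hC1 : 0 < ‖C.1‖ := norm_pos_iff.2 fun h => by simp [h, h2] at h1
  refine (hx.pos_mul_atTop hC1 (tendsto_inv_nhdsGT_zero.comp hs)).congr fun t => ?_
  rw [norm_div, Complex.norm_real, Real.norm_of_nonneg (hγ.snd_pos t).le]
  rfl

/-- In the affine chart `w = x / s`, an interior saddle connection is a proper orbit. -/
theorem isProperOrbit (hγ : IsInteriorSaddleConnection e A B γ) (hd : 1 ≤ d) :
    IsProperOrbit (fun x => (poly e).eval x) (fun t => (γ t).2 ^ (d - 1))
      (fun t => (γ t).1 / ((γ t).2 : ℂ)) where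
  pos t := pow_pos (hγ.snd_pos t) _
  continuous_rate :=
    (continuous_iff_continuousAt.2 fun t => (hγ.orbit t).continuousAt).snd.pow _
  hasDerivAt t := by
    have hne : ((γ t).2 : ℂ) ≠ 0 := by exact_mod_cast (hγ.snd_pos t).ne'
    have h1 : HasDerivAt (fun t => (γ t).1) (compactField e (γ t)).1 t :=
      (ContinuousLinearMap.fst ℝ ℂ ℝ).hasFDerivAt.comp_hasDerivAt t (hγ.orbit t)
    have h2 : HasDerivAt (fun t => (γ t).2) (compactField e (γ t)).2 t :=
      (ContinuousLinearMap.snd ℝ ℂ ℝ).hasFDerivAt.comp_hasDerivAt t (hγ.orbit t)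
    refine (h1.div h2.ofReal_comp hne).congr_deriv ?_
    rw [velocity_eq e hd _ (hγ.snd_pos t)]
    push_cast
    rfl
  ne_zero t h0 := by
    have hne : ((γ t).2 : ℂ) ≠ 0 := by exact_mod_cast (hγ.snd_pos t).ne'
    rw [eval_poly, Finset.prod_eq_zero_iff] at h0
    obtain ⟨j, hj, h0⟩ := h0
    have hF : homog e (γ t) = 0 :=
      Finset.prod_eq_zero hj (by rw [sub_eq_zero, ← div_eq_iff hne]; exact sub_eq_zero.1 h0)
    exact hγ.compactField_ne_zero t (by simp [compactField, hF])
  injective a b hab := hγ.injective <| by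
    rw [← toDisk_div_of_mem_openDisk (hγ.mem_openDisk a),
      ← toDisk_div_of_mem_openDisk (hγ.mem_openDisk b)]
    exact congrArg toDisk hab
  tendsto_atBot := hγ.tendsto_norm_div hγ.source_mem.1 hγ.tendsto_source
  tendsto_atTop := hγ.tendsto_norm_div hγ.target_mem.1 hγ.tendsto_target

theorem image_toDisk_compl_range (hγ : IsInteriorSaddleConnection e A B γ) :
    toDisk '' (range fun t => (γ t).1 / ((γ t).2 : ℂ))ᶜ = openDisk \ range γ := by
  ext p
  constructor
  · rintro ⟨w, hw, rfl⟩
    refine ⟨toDisk_mem_openDisk w, ?_⟩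
    rintro ⟨t, ht⟩
    exact hw ⟨t, by simp only [ht, toDisk_fst_div_snd]⟩
  · rintro ⟨hp, hpγ⟩
    refine ⟨p.1 / p.2, ?_, toDisk_div_of_mem_openDisk hp⟩
    rintro ⟨t, ht⟩
    refine hpγ ⟨t, ?_⟩
    rw [← toDisk_div_of_mem_openDisk (hγ.mem_openDisk t), ← toDisk_div_of_mem_openDisk hp]
    exact congrArg toDisk ht

theorem image_div_openDisk_diff_range (hγ : IsInteriorSaddleConnection e A B γ) :
    (fun p : ℂ × ℝ => p.1 / (p.2 : ℂ)) '' (openDisk \ range γ) =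
      (range fun t => (γ t).1 / ((γ t).2 : ℂ))ᶜ := by
  rw [← hγ.image_toDisk_compl_range, image_image]
  simp only [toDisk_fst_div_snd, image_id']

/-- Central projection and its inverse are continuous and match the two complements, so each carries
components into components. -/
theorem toDisk_mem_component_iff (hγ : IsInteriorSaddleConnection e A B γ) {p q : ℂ}
    (hq : q ∉ range fun t => (γ t).1 / ((γ t).2 : ℂ)) :
    toDisk p ∈ connectedComponentIn (openDisk \ range γ) (toDisk q) ↔
      p ∈ connectedComponentIn (range fun t => (γ t).1 / ((γ t).2 : ℂ))ᶜ q := by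
  constructor
  · intro h
    have hcont : ContinuousOn (fun p : ℂ × ℝ => p.1 / (p.2 : ℂ)) (openDisk \ range γ) :=
      continuous_fst.continuousOn.div
        (Complex.continuous_ofReal.comp continuous_snd).continuousOn
        fun p hp => by exact_mod_cast hp.1.2.ne'
    have hmem : toDisk q ∈ openDisk \ range γ :=
      hγ.image_toDisk_compl_range ▸ mem_image_of_mem toDisk hq
    have := hcont.mapsTo_connectedComponentIn hmem h
    simpa only [hγ.image_div_openDisk_diff_range, toDisk_fst_div_snd] using this
  · intro h
    have := continuous_toDisk.continuousOn.mapsTo_connectedComponentIn hq h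
    rwa [hγ.image_toDisk_compl_range] at this

end IsInteriorSaddleConnection

end PoincareCompactification

theorem mainTheorem10 (d : ℕ) (hd : 2 ≤ d) (e : Fin d → ℂ) (he : Function.Injective e)
    (A B : ℂ × ℝ) (γ : ℝ → ℂ × ℝ)
    (hγ : PoincareCompactification.IsInteriorSaddleConnection e A B γ) :
    (PoincareCompactification.oppositeSide e γ ⟨0, by omega⟩).Nonempty ∧
      ∑ j ∈ PoincareCompactification.oppositeSide e γ ⟨0, by omega⟩,
        (PoincareCompactification.eta e j).re = 0 := by
  have h := hγ.isProperOrbit (by omega)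
  refine h.sum_eta_re_eq_zero hd he ⟨0, by omega⟩ fun j => ?_
  have h0 : e ⟨0, by omega⟩ ∉ Set.range fun t => (γ t).1 / ((γ t).2 : ℂ) := by
    rintro ⟨t, ht⟩
    exact h.ne_zero t (by simp only [ht, PoincareCompactification.eval_poly_eq_zero])
  rw [← hγ.toDisk_mem_component_iff h0]
  simp [PoincareCompactification.oppositeSide]
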